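/- Let $S$ be a semigroup generated by its squares, i.e. every $x\in S$ can be written $x=x_1^2\cdots x_n^2$ with $n\ge 1$ and $x_1,\dots,x_n\in S$. Call a map $\chi:S\to\mathbb C$ multiplicative if $\chi(xy)=\chi(x)\chi(y)$ for all $x,y$ (the zero map is allowed). For a multiplicative $\chi\neq0$ put $I_\chi=\{x\in S:\chi(x)=0\}$, so that $S\setminus I_\chi$ is a subsemigroup, and for $\varphi:S\setminus I_\chi\to\mathbb C$ let $\Psi_\chi(\varphi):S\to\mathbb C$ be the function equal to $\chi(x)\varphi(x)$ for $x\in S\setminus I_\chi$ and to $0$ for $x\in I_\chi$. A map $A$ from a semigroup to $\mathbb C$ is additive if $A(xy)=A(x)+A(y)$ for all $x,y$. Let $\lambda_2\in\mathbb C\setminus\{0\}$. Functions $f,g_1,h,g_2:S\to\mathbb C$ satisfy, for all $x,y\in S$, $$f(xy)=f(x)g_1(y)+g_1(x)f(y),$$ $$h(xy)=h(x)g_2(y)+g_2(x)h(y)+\lambda_2^2f(x)f(y),$$ with $f$ and $h$ linearly independent over $\mathbb{C}$, if and only if they have one of the following forms, where $m,\mu,\chi_1,\chi_2,\chi_3:S\to\mathbb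 C$ are multiplicative, $m\ne0$, $m\neq\mu$, $\chi_1,\chi_2,\chi_3$ are pairwise different, $A,A_1:S\setminus I_m\to\mathbb C$ are additive, $A\neq0$ (while $A_1$ may be $0$), and $\alpha,\beta,\lambda,c,d\in\mathbb C\setminus\{0\}$ are constants: 1. $f=\Psi_m(A)$, $g_1=m$, $h=\frac12\Psi_m(A_1+\lambda_2^2A^2)$, $g_2=m$. 2. $f=\alpha(\mu-m)$, $g_1=\frac{\mu+m}2$, $h=\alpha^2\lambda_2^2(\mu-m)-\alpha\lambda_2\Psi_m(A)$, $g_2=m$. 3. $f=\frac1{\lambda_2}\Psi_m(A)$, $g_1=m$, $h=c^2(\mu-m)-c\,\Psi_m(A)$, $g_2=\frac{\mu+m}2+\frac1{2c}\Psi_m(A)$. 4. $f=-\frac1{d\lambda_2}(\mu-m)$, $g_1=\frac{\mu+m}2$, $h=c(\mu-m)+\frac1d\Psi_m(A)$, $g_2=m$, with $1-cd^2=0$. 5. $f=\frac1{\lambda_2}\Psi_m(A)$, $g_1=m$, $h=c(\mu-m)+\frac1d\Psi_m(A)$, $g_2=\frac{\mu+m}2-\frac12d\,\Psi_m(A)$,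 with $1-cd^2=0$. 6. $f=\frac{\chi_1-\chi_2}{2\lambda\lambda_2}$, $g_1=\frac{\chi_1+\chi_2}2$, $h=c\beta\chi_1+c(2-\beta)\chi_2-2c\chi_3$, $g_2=\frac{\beta\chi_1+(2-\beta)\chi_2+2\chi_3}4$, with $2c\lambda^2\beta(2-\beta)=1$. 7. $f=\frac1{\lambda\lambda_2(2-\beta)}(\chi_1-\chi_3)$, $g_1=\frac{\chi_1+\chi_3}2$, $h=c\beta\chi_1+c(2-\beta)\chi_2-2c\chi_3$, $g_2=\frac{-\beta\chi_1+(2-\beta)\chi_2+2\chi_3}{2(2-\beta)}$, with $2c\lambda^2\beta(2-\beta)=1$. 8. $f=-\frac1{\lambda\lambda_2\beta}(\chi_2-\chi_3)$, $g_1=\frac{\chi_2+\chi_3}2$, $h=c\beta\chi_1+c(2-\beta)\chi_2-2c\chi_3$, $g_2=\frac{\beta\chi_1-(2-\beta)\chi_2+2\chi_3}{2\beta}$, with $2c\lambda^2\beta(2-\beta)=1$. -/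

import Mathlib

/-- `S` is generated by its squares: every element is a finite (nonempty) product
of squares `x₁ ^ 2 ⋯ xₙ ^ 2`. -/
def GeneratedBySquares (S : Type*) [Semigroup S] : Prop :=
  ∀ x : S, x ∈ Subsemigroup.closure (Set.range fun y : S => y * y)

/-- Additive complex functions: homomorphisms into `(ℂ, +)`. -/
def IsAdditive {T : Type*} [Mul T] (a : T → ℂ) : Prop :=
  ∀ x y : T, a (x * y) = a x + a y

/-- The subsemigroup `S ∖ I_χ`, where `I_χ = {x | χ x = 0}`. -/
def nonvanishing {S : Type*} [Semigroup S] (χ : S →ₙ* ℂ) : Subsemigroup S where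
  carrier := {x | χ x ≠ 0}
  mul_mem' := by
    intro x y hx hy
    simp only [Set.mem_ofPred_eq, map_mul] at hx hy ⊢
    exact mul_ne_zero hx hy

open Classical in
/-- `Ψ_χ(φ)`: equal to `χ(x) φ(x)` on `S ∖ I_χ` and to `0` on `I_χ`. -/
noncomputable def Psi {S : Type*} [Semigroup S] (χ : S →ₙ* ℂ)
    (φ : nonvanishing χ → ℂ) : S → ℂ :=
  fun x => if hx : x ∈ nonvanishing χ then χ x * φ ⟨x, hx⟩ else 0

/-- The system
`f(xy) = f(x)g₁(y) + g₁(x)f(y)`, `h(xy) = h(x)g₂(y) + g₂(x)h(y) + l² f(x)f(y)`. -/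
def IsSolution {S : Type*} [Semigroup S] (l : ℂ) (f g₁ h g₂ : S → ℂ) : Prop :=
  (∀ x y : S, f (x * y) = f x * g₁ y + g₁ x * f y) ∧
  (∀ x y : S, h (x * y) = h x * g₂ y + g₂ x * h y + l ^ 2 * (f x * f y))

/-! ### The sine addition law with a multiplicative companion -/

section Psi

variable {S : Type*} [Semigroup S] {m : S →ₙ* ℂ}

/-! Associativity carries the proof. Comparing `h ((x * y) * z)` with `h (x * (y * z))`, and
likewise for `f`, gives constants `a`, `b` with g₁ = g₂ + a h + b l f and an addition formula for g₂
(`exists_linear_relation`). Hence g₂ - a h and g₁ ± k l f are multiplicative, where k² = 2a + b². If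
a and k are nonzero, these are three different multiplicative maps, and inverting the linear
relations gives form 6. If a or k is zero, some of these maps coincide, and a combination of f and h
solves the sine addition law with a multiplicative companion, hence is some Ψ_m(A)
(`exists_additive_eq_psi`, the only use of generation by squares). This gives forms 1 to 3. Every
solution thus has form 1, 2, 3 or 6. Forms 4 and 5 are reparametrized 2 and 3; forms 7 and 8 permute
the characters of 6. In the converse, independence of f and h comes from that of the building
blocks. -/

theorem psi_of_ne_zero (φ : nonvanishing m → ℂ) {x : S} (hx : m x ≠ 0) :
    Psi m φ x = m x * φ ⟨x, hx⟩ :=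
  dif_pos hx

theorem psi_of_eq_zero (φ : nonvanishing m → ℂ) {x : S} (hx : m x = 0) : Psi m φ x = 0 :=
  dif_neg fun h : m x ≠ 0 => h hx

theorem psi_ne_zero {A : nonvanishing m → ℂ} (h0 : A ≠ 0) :
    ∃ x, m x ≠ 0 ∧ Psi m A x ≠ 0 := by
  obtain ⟨⟨x, hx⟩, hA⟩ := Function.ne_iff.1 h0
  refine ⟨x, hx, ?_⟩
  rw [psi_of_ne_zero A hx]
  exact mul_ne_zero hx hA

/-- `Ψ_m(A)` and `m` solve the sine addition law when `A` is additive. -/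
theorem psi_mul {A : nonvanishing m → ℂ} (hA : IsAdditive A) (x y : S) :
    Psi m A (x * y) = Psi m A x * m y + m x * Psi m A y := by
  by_cases hx : m x = 0
  · rw [psi_of_eq_zero A (x := x * y) (by simp [hx]), psi_of_eq_zero A hx, hx]; ring
  by_cases hy : m y = 0
  · rw [psi_of_eq_zero A (x := x * y) (by simp [hy]), psi_of_eq_zero A hy, hy]; ring
  have hxy : m (x * y) ≠ 0 := by rw [map_mul]; exact mul_ne_zero hx hy
  rw [psi_of_ne_zero A hx, psi_of_ne_zero A hy, psi_of_ne_zero A hxy, map_mul]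
  have := hA ⟨x, hx⟩ ⟨y, hy⟩
  change A ⟨x * y, hxy⟩ = _ at this
  rw [this]; ring

theorem psi_sq_mul {A : nonvanishing m → ℂ} (hA : IsAdditive A) (x y : S) :
    Psi m (fun t => A t ^ 2) (x * y) =
      Psi m (fun t => A t ^ 2) x * m y + m x * Psi m (fun t => A t ^ 2) y
        + 2 * (Psi m A x * Psi m A y) := by
  by_cases hx : m x = 0
  · rw [psi_of_eq_zero _ (x := x * y) (by simp [hx]), psi_of_eq_zero _ hx,
      psi_of_eq_zero _ hx, hx]; ring
  by_cases hy : m y = 0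
  · rw [psi_of_eq_zero _ (x := x * y) (by simp [hy]), psi_of_eq_zero _ hy,
      psi_of_eq_zero _ hy, hy]; ring
  have hxy : m (x * y) ≠ 0 := by rw [map_mul]; exact mul_ne_zero hx hy
  rw [psi_of_ne_zero _ hx, psi_of_ne_zero _ hy, psi_of_ne_zero _ hxy, psi_of_ne_zero _ hx,
    psi_of_ne_zero _ hy, map_mul]
  have := hA ⟨x, hx⟩ ⟨y, hy⟩
  change A ⟨x * y, hxy⟩ = _ at this
  rw [this]; ring

theorem psi_add_const_mul (φ ψ : nonvanishing m → ℂ) (k : ℂ) (x : S) :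
    Psi m (fun t => φ t + k * ψ t) x = Psi m φ x + k * Psi m ψ x := by
  by_cases hx : m x = 0
  · simp [psi_of_eq_zero _ hx]
  · simp only [psi_of_ne_zero _ hx]; ring

/-- On a semigroup generated by its squares, every solution `P` of the sine addition law with a
multiplicative companion `m` is of the form `Ψ_m(A)`. -/
theorem exists_additive_eq_psi (hS : GeneratedBySquares S) {P : S → ℂ}
    (hP : ∀ x y, P (x * y) = P x * m y + m x * P y) :
    ∃ A : nonvanishing m → ℂ, IsAdditive A ∧ P = Psi m A := by
  -- Generation by squares enters here: P(y²) = 2 P(y) m(y) vanishes as soon as m(y²) = m(y)² does,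
  -- and the property passes to products.
  have hzero : ∀ x, m x = 0 → P x = 0 := by
    intro x
    induction hS x using Subsemigroup.closure_induction with
    | mem x hx =>
      obtain ⟨y, rfl⟩ := hx
      intro hy
      have hy : m y = 0 := by simpa using hy
      simp [hP, hy]
    | mul x y _ _ ihx ihy =>
      intro hxy
      rw [map_mul, mul_eq_zero] at hxy
      rcases hxy with h | h
      · simp [hP, h, ihx h]
      · simp [hP, h, ihy h]
  refine ⟨fun t => P t / m t, ?_, ?_⟩
  · rintro ⟨x, hx⟩ ⟨y, hy⟩
    change P (x * y) / m (x * y) = P x / m x + P y / m y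
    have hx : m x ≠ 0 := hx
    have hy : m y ≠ 0 := hy
    rw [hP, map_mul]
    field_simp
  · funext x
    by_cases hx : m x = 0
    · rw [hzero x hx, psi_of_eq_zero _ hx]
    · rw [psi_of_ne_zero _ hx, mul_div_cancel₀ _ hx]

theorem exists_additive_ne_zero_eq_psi (hS : GeneratedBySquares S) {P : S → ℂ}
    (hP : ∀ x y, P (x * y) = P x * m y + m x * P y) (h0 : P ≠ 0) :
    (m : S → ℂ) ≠ 0 ∧ ∃ A : nonvanishing m → ℂ, IsAdditive A ∧ A ≠ 0 ∧ P = Psi m A := by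
  obtain ⟨A, hA, rfl⟩ := exists_additive_eq_psi hS hP
  obtain ⟨x, hx⟩ := Function.ne_iff.1 h0
  have hmx : m x ≠ 0 := fun h => hx (psi_of_eq_zero A h)
  refine ⟨fun h => hmx (congrFun h x), A, hA, ?_, rfl⟩
  rintro rfl
  exact hx (by simp [psi_of_ne_zero _ hmx])

end Psi

/-! ### Linear independence of the building blocks -/

section Independence

variable {S : Type*}

theorem linearIndependent_pair_of_forall {f h : S → ℂ}
    (H : ∀ s t : ℂ, (∀ x, s * f x + t * h x = 0) → s = 0 ∧ t = 0) :
    LinearIndependent ℂ ![f, h] :=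
  LinearIndependent.pair_iff.2 fun s t hst => H s t fun x => congrFun hst x

theorem forall_of_linearIndependent_pair {f h : S → ℂ} (H : LinearIndependent ℂ ![f, h])
    {s t : ℂ} (hst : ∀ x, s * f x + t * h x = 0) : s = 0 ∧ t = 0 :=
  LinearIndependent.pair_iff.1 H s t (funext hst)

variable [Semigroup S]

/-- Pairwise different multiplicative maps, one of which may vanish, satisfy no nontrivial linear
relation with coefficient sum zero. -/
theorem eq_zero_of_sum_mulHom_eq_zero {χ₁ χ₂ χ₃ : S →ₙ* ℂ} (h12 : χ₁ ≠ χ₂) (h13 : χ₁ ≠ χ₃)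
    (h23 : χ₂ ≠ χ₃) {p q r : ℂ} (hsum : p + q + r = 0)
    (h : ∀ x, p * χ₁ x + q * χ₂ x + r * χ₃ x = 0) : p = 0 ∧ q = 0 ∧ r = 0 := by
  -- Adjoining an identity turns the maps, even a zero map, into distinct monoid homomorphisms, to
  -- which Dedekind's theorem applies. At the new identity the relation reads p + q + r = 0.
  have hinj : Function.Injective
      ![WithOne.lift χ₁, WithOne.lift χ₂, WithOne.lift χ₃] := by
    intro i j hij
    fin_cases i <;> fin_cases j <;> simp_all [eq_comm]
  have hli := (linearIndependent_monoidHom (WithOne S) ℂ).comp _ hinj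
  have key := Fintype.linearIndependent_iff.1 hli ![p, q, r] (by
    funext x
    refine WithOne.cases_on x ?_ fun x => ?_
    · simpa [Fin.sum_univ_three] using hsum
    · simpa [Fin.sum_univ_three] using h x)
  exact ⟨key 0, key 1, key 2⟩

/-- `Ψ_m(A)` is not a multiple of `μ - m`. -/
theorem eq_zero_of_mul_sub_add_mul_psi_eq_zero {m μ : S →ₙ* ℂ} {A : nonvanishing m → ℂ}
    (hmμ : m ≠ μ) (hA : IsAdditive A) (h0 : A ≠ 0) {s t : ℂ}
    (h : ∀ x, s * (μ x - m x) + t * Psi m A x = 0) : s = 0 ∧ t = 0 := by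
  have ht : t = 0 := by
    obtain ⟨x, hm, hP⟩ := psi_ne_zero h0
    by_contra ht
    have h1 := h x
    have h2 := h (x * x)
    rw [psi_mul hA, map_mul, map_mul] at h2
    -- Subtracting 2 m(x) times the relation at x from that at x² cancels the Ψ term.
    have h3 : s * (μ x - m x) ^ 2 = 0 := by linear_combination h2 - 2 * m x * h1
    have h4 : s * (μ x - m x) = 0 := by
      rcases mul_eq_zero.1 h3 with hs | hs
      · rw [hs, zero_mul]
      · rw [pow_eq_zero_iff two_ne_zero] at hs; rw [hs, mul_zero]
    rw [h4, zero_add] at h1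
    exact (mul_ne_zero ht hP) h1
  refine ⟨?_, ht⟩
  obtain ⟨x, hx⟩ := DFunLike.ne_iff.1 hmμ
  have := h x
  rw [ht, zero_mul, add_zero] at this
  exact (mul_eq_zero.1 this).resolve_right (sub_ne_zero.2 hx.symm)

end Independence

/-! ### The listed forms are solutions -/

section Solutions

variable {S : Type*} [Semigroup S] {l : ℂ}

theorem isSolution_psi_sq {m : S →ₙ* ℂ} {A A₁ : nonvanishing m → ℂ} (hl : l ≠ 0)
    (hA : IsAdditive A) (hA₁ : IsAdditive A₁) (h0 : A ≠ 0) :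
    IsSolution l (Psi m A) m (fun x => 1 / 2 * Psi m (fun t => A₁ t + l ^ 2 * A t ^ 2) x) m ∧
      LinearIndependent ℂ
        ![Psi m A, fun x => 1 / 2 * Psi m (fun t => A₁ t + l ^ 2 * A t ^ 2) x] := by
  simp only [psi_add_const_mul A₁ (fun t => A t ^ 2) (l ^ 2)]
  refine ⟨⟨psi_mul hA, fun x y => ?_⟩, linearIndependent_pair_of_forall fun s t H => ?_⟩
  · simp only [psi_mul hA₁, psi_sq_mul hA]; ring
  · obtain ⟨x, hm, hP⟩ := psi_ne_zero h0
    have h1 := H x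
    have h2 := H (x * x)
    rw [psi_mul hA, psi_mul hA₁, psi_sq_mul hA] at h2
    have h3 : t * l ^ 2 * Psi m A x ^ 2 = 0 := by linear_combination h2 - 2 * m x * h1
    have ht : t = 0 := by simpa [hl, hP] using h3
    exact ⟨by simpa [ht, hP] using h1, ht⟩

theorem isSolution_sub_psi {m μ : S →ₙ* ℂ} {A : nonvanishing m → ℂ} {α : ℂ} (hl : l ≠ 0)
    (hmμ : m ≠ μ) (hA : IsAdditive A) (h0 : A ≠ 0) (hα : α ≠ 0) :
    IsSolution l (fun x => α * (μ x - m x)) (fun x => (μ x + m x) / 2)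
        (fun x => α ^ 2 * l ^ 2 * (μ x - m x) - α * l * Psi m A x) m ∧
      LinearIndependent ℂ ![fun x => α * (μ x - m x),
        fun x => α ^ 2 * l ^ 2 * (μ x - m x) - α * l * Psi m A x] := by
  refine ⟨⟨fun x y => ?_, fun x y => ?_⟩, linearIndependent_pair_of_forall fun s t H => ?_⟩
  · simp only [map_mul]; ring
  · simp only [map_mul, psi_mul hA]; ring
  · obtain ⟨h1, h2⟩ := eq_zero_of_mul_sub_add_mul_psi_eq_zero hmμ hA h0
      (s := s * α + t * (α ^ 2 * l ^ 2)) (t := -(t * (α * l)))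
      fun x => by linear_combination H x
    have ht : t = 0 := by simpa [hα, hl] using h2
    exact ⟨by simpa [ht, hα] using h1, ht⟩

theorem isSolution_psi_sub {m μ : S →ₙ* ℂ} {A : nonvanishing m → ℂ} {c : ℂ} (hl : l ≠ 0)
    (hmμ : m ≠ μ) (hA : IsAdditive A) (h0 : A ≠ 0) (hc : c ≠ 0) :
    IsSolution l (fun x => 1 / l * Psi m A x) m
        (fun x => c ^ 2 * (μ x - m x) - c * Psi m A x)
        (fun x => (μ x + m x) / 2 + 1 / (2 * c) * Psi m A x) ∧
      LinearIndependent ℂ ![fun x => 1 / l * Psi m A x,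
        fun x => c ^ 2 * (μ x - m x) - c * Psi m A x] := by
  refine ⟨⟨fun x y => ?_, fun x y => ?_⟩, linearIndependent_pair_of_forall fun s t H => ?_⟩
  · simp only [psi_mul hA]; ring
  · simp only [map_mul, psi_mul hA]; field_simp; ring
  · obtain ⟨h1, h2⟩ := eq_zero_of_mul_sub_add_mul_psi_eq_zero hmμ hA h0
      (s := t * c ^ 2) (t := s * (1 / l) - t * c)
      fun x => by linear_combination H x
    have ht : t = 0 := by simpa [hc] using h1
    exact ⟨by simpa [ht, hl] using h2, ht⟩

/-- Common source of forms 6 to 8, according to which character plays χ₃. Since h + 2r g₂ = 2r χ₃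
and h - 2r g₂ = 2(p χ₁ + q χ₂), polarization together with p + q + r = 0 reduces the defect of the
second equation to -(pq/r) (χ₁ - χ₂)(x) (χ₁ - χ₂)(y), which `hrel` matches with l² f(x) f(y). -/
theorem isSolution_of_three_mulHom {χ₁ χ₂ χ₃ : S →ₙ* ℂ} (h12 : χ₁ ≠ χ₂) (h13 : χ₁ ≠ χ₃)
    (h23 : χ₂ ≠ χ₃) {k p q r : ℂ} (hk : k ≠ 0) (hr : r ≠ 0) (hsum : p + q + r = 0)
    (hrel : l ^ 2 * k ^ 2 * r = -(p * q)) {f g₁ h g₂ : S → ℂ}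
    (hf : f = fun x => k * (χ₁ x - χ₂ x)) (hg₁ : g₁ = fun x => (χ₁ x + χ₂ x) / 2)
    (hh : h = fun x => p * χ₁ x + q * χ₂ x + r * χ₃ x)
    (hg₂ : g₂ = fun x => (-p * χ₁ x - q * χ₂ x + r * χ₃ x) / (2 * r)) :
    IsSolution l f g₁ h g₂ ∧ LinearIndependent ℂ ![f, h] := by
  subst hf hg₁ hh hg₂
  refine ⟨⟨fun x y => ?_, fun x y => ?_⟩, linearIndependent_pair_of_forall fun s t H => ?_⟩
  · simp only [map_mul]; ring
  · simp only [map_mul]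
    field_simp
    linear_combination (-2 * ((χ₁ x - χ₂ x) * (χ₁ y - χ₂ y))) * hrel
      + 2 * (p * χ₁ x * χ₁ y + q * χ₂ x * χ₂ y) * hsum
  · obtain ⟨h1, -, h3⟩ := eq_zero_of_sum_mulHom_eq_zero h12 h13 h23
      (p := s * k + t * p) (q := -(s * k) + t * q) (r := t * r)
      (by linear_combination t * hsum) fun x => by linear_combination H x
    have ht : t = 0 := by simpa [hr] using h3
    exact ⟨by simpa [ht, hk] using h1, ht⟩

end Solutions

/-! ### Consequences of associativity -/

section Structure

variable {S : Type*} [Semigroup S] {l : ℂ} {f g₁ h g₂ : S → ℂ}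

theorem exists_linear_relation (hsol : IsSolution l f g₁ h g₂)
    (hl : l ≠ 0) (hli : LinearIndependent ℂ ![f, h]) :
    ∃ a b : ℂ, (∀ x, g₁ x = g₂ x + a * h x + b * (l * f x)) ∧
      ∀ x y, g₂ (x * y) = g₂ x * g₂ y + a ^ 2 * (h x * h y) + a * (l ^ 2 * (f x * f y)) := by
  obtain ⟨hf, hh⟩ := hsol
  have hf0 : ∃ x, f x ≠ 0 := by
    by_contra! H
    simpa using (forall_of_linearIndependent_pair hli (s := 1) (t := 0) (by simp [H])).1
  have hh0 : ∃ x, h x ≠ 0 := by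
    by_contra! H
    simpa using (forall_of_linearIndependent_pair hli (s := 0) (t := 1) (by simp [H])).2
  obtain ⟨u, hu⟩ := hf0
  obtain ⟨v, hv⟩ := hh0
  have assoc : ∀ x y z, h z * (g₂ (x * y) - g₂ x * g₂ y) + l ^ 2 * (f z * f y * (g₁ x - g₂ x)) =
      h x * (g₂ (y * z) - g₂ y * g₂ z) + l ^ 2 * (f x * f y * (g₁ z - g₂ z)) := by
    intro x y z
    have e := congrArg h (mul_assoc x y z)
    simp only [hh, hf] at e
    linear_combination e
  obtain ⟨w, hw⟩ : ∃ w, h v * f w - h w * f v ≠ 0 := by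
    by_contra! H
    exact hv (forall_of_linearIndependent_pair hli (s := h v) (t := - f v)
      fun x => by linear_combination H x).1
  -- With y = u fixed, the instances z = v and z = w are linear in the unknowns g₂(xu) - g₂(x) g₂(u)
  -- and g₁(x) - g₂(x); Cramer's rule eliminates the first.
  have he : ∃ a b : ℂ, ∀ x, g₁ x - g₂ x = a * h x + b * (l * f x) := by
    refine ⟨(h v * (g₂ (u * w) - g₂ u * g₂ w) - h w * (g₂ (u * v) - g₂ u * g₂ v)) /
        (l ^ 2 * f u * (h v * f w - h w * f v)),
      (h v * (g₁ w - g₂ w) - h w * (g₁ v - g₂ v)) / (l * (h v * f w - h w * f v)), fun x => ?_⟩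
    have e1 := assoc x u v
    have e2 := assoc x u w
    field_simp
    linear_combination h v * e2 - h w * e1
  obtain ⟨a, b, he⟩ := he
  have sym : ∀ x y z,
      h z * (g₂ (x * y) - g₂ x * g₂ y - a * (l ^ 2 * (f x * f y))) =
      h x * (g₂ (y * z) - g₂ y * g₂ z - a * (l ^ 2 * (f y * f z))) := by
    intro x y z
    have e := assoc x y z
    rw [he x, he z] at e
    linear_combination e
  -- By `sym`, the defect D(x, y) = g₂(xy) - g₂(x) g₂(y) - a l² f(x) f(y) satisfies h(z) D(x, y) =
  -- h(x) D(y, z); using this twice with v gives D(x, y) = κ h(x) h(y).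
  obtain ⟨κ, hκ⟩ : ∃ κ : ℂ, ∀ x y,
      g₂ (x * y) = g₂ x * g₂ y + κ * (h x * h y) + a * (l ^ 2 * (f x * f y)) := by
    refine ⟨(g₂ (v * v) - g₂ v * g₂ v - a * (l ^ 2 * (f v * f v))) / h v ^ 2, fun x y => ?_⟩
    have e1 := sym x y v
    have e2 := sym y v v
    field_simp
    linear_combination h v * e1 + h x * e2
  have hg : ∀ x, g₁ x = g₂ x + a * h x + b * (l * f x) := fun x => by
    linear_combination he x
  refine ⟨a, b, hg, ?_⟩
  have hfa : ∀ x y z, f z * (g₁ (x * y) - g₁ x * g₁ y) = f x * (g₁ (y * z) - g₁ y * g₁ z) := by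
    intro x y z
    have e := congrArg f (mul_assoc x y z)
    simp only [hf] at e
    linear_combination e
  have hdiff : ∀ x y, g₁ (x * y) - g₁ x * g₁ y =
      (κ - a ^ 2) * (h x * h y) + (2 * a + b ^ 2) * (l ^ 2 * (f x * f y)) := by
    intro x y
    have e := hf x y
    rw [hg x, hg y] at e
    rw [hg (x * y), hg x, hg y, hκ, hh, e]
    ring
  -- In `hfa` the contributions of f(x) f(y) cancel; were κ ≠ a², what remains would make f and h
  -- proportional.
  have hκa : κ - a ^ 2 = 0 := by
    by_contra hne
    have e : ∀ x y z, h y * (f z * h x - f x * h z) = 0 := fun x y z => by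
      have e := hfa x y z
      rw [hdiff, hdiff] at e
      apply mul_left_cancel₀ hne
      linear_combination e
    have := e w v v
    rcases mul_eq_zero.1 this with h | h
    · exact hv h
    · exact hw (by linear_combination -h)
  intro x y
  rw [hκ, sub_eq_zero.1 hκa]

end Structure

/-! ### The classification -/

theorem theorem1 {S : Type*} [Semigroup S] (hS : GeneratedBySquares S)
    (lam₂ : ℂ) (hlam₂ : lam₂ ≠ 0) (f g₁ h g₂ : S → ℂ) :
    (IsSolution lam₂ f g₁ h g₂ ∧ LinearIndependent ℂ ![f, h]) ↔
      -- (1)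
      ((∃ (m : S →ₙ* ℂ) (A A₁ : nonvanishing m → ℂ),
          (m : S → ℂ) ≠ 0 ∧ IsAdditive A ∧ IsAdditive A₁ ∧ A ≠ 0 ∧
          f = Psi m A ∧
          g₁ = m ∧
          h = (fun x => 1 / 2 * Psi m (fun t => A₁ t + lam₂ ^ 2 * A t ^ 2) x) ∧
          g₂ = m) ∨
      -- (2)
       (∃ (m μ : S →ₙ* ℂ) (A : nonvanishing m → ℂ) (α : ℂ),
          (m : S → ℂ) ≠ 0 ∧ m ≠ μ ∧ IsAdditive A ∧ A ≠ 0 ∧ α ≠ 0 ∧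
          f = (fun x => α * (μ x - m x)) ∧
          g₁ = (fun x => (μ x + m x) / 2) ∧
          h = (fun x => α ^ 2 * lam₂ ^ 2 * (μ x - m x) - α * lam₂ * Psi m A x) ∧
          g₂ = m) ∨
      -- (3)
       (∃ (m μ : S →ₙ* ℂ) (A : nonvanishing m → ℂ) (c : ℂ),
          (m : S → ℂ) ≠ 0 ∧ m ≠ μ ∧ IsAdditive A ∧ A ≠ 0 ∧ c ≠ 0 ∧
          f = (fun x => 1 / lam₂ * Psi m A x) ∧
          g₁ = m ∧
          h = (fun x => c ^ 2 * (μ x - m x) - c * Psi m A x) ∧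
          g₂ = (fun x => (μ x + m x) / 2 + 1 / (2 * c) * Psi m A x)) ∨
      -- (4)
       (∃ (m μ : S →ₙ* ℂ) (A : nonvanishing m → ℂ) (c d : ℂ),
          (m : S → ℂ) ≠ 0 ∧ m ≠ μ ∧ IsAdditive A ∧ A ≠ 0 ∧ c ≠ 0 ∧ d ≠ 0 ∧
          1 - c * d ^ 2 = 0 ∧
          f = (fun x => -(1 / (d * lam₂)) * (μ x - m x)) ∧
          g₁ = (fun x => (μ x + m x) / 2) ∧
          h = (fun x => c * (μ x - m x) + 1 / d * Psi m A x) ∧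
          g₂ = m) ∨
      -- (5)
       (∃ (m μ : S →ₙ* ℂ) (A : nonvanishing m → ℂ) (c d : ℂ),
          (m : S → ℂ) ≠ 0 ∧ m ≠ μ ∧ IsAdditive A ∧ A ≠ 0 ∧ c ≠ 0 ∧ d ≠ 0 ∧
          1 - c * d ^ 2 = 0 ∧
          f = (fun x => 1 / lam₂ * Psi m A x) ∧
          g₁ = m ∧
          h = (fun x => c * (μ x - m x) + 1 / d * Psi m A x) ∧
          g₂ = (fun x => (μ x + m x) / 2 - 1 / 2 * d * Psi m A x)) ∨
      -- (6)
       (∃ (χ₁ χ₂ χ₃ : S →ₙ* ℂ) (β lam c : ℂ),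
          χ₁ ≠ χ₂ ∧ χ₁ ≠ χ₃ ∧ χ₂ ≠ χ₃ ∧ β ≠ 0 ∧ lam ≠ 0 ∧ c ≠ 0 ∧
          2 * c * lam ^ 2 * β * (2 - β) = 1 ∧
          f = (fun x => (χ₁ x - χ₂ x) / (2 * lam * lam₂)) ∧
          g₁ = (fun x => (χ₁ x + χ₂ x) / 2) ∧
          h = (fun x => c * β * χ₁ x + c * (2 - β) * χ₂ x - 2 * c * χ₃ x) ∧
          g₂ = (fun x => (β * χ₁ x + (2 - β) * χ₂ x + 2 * χ₃ x) / 4)) ∨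
      -- (7)
       (∃ (χ₁ χ₂ χ₃ : S →ₙ* ℂ) (β lam c : ℂ),
          χ₁ ≠ χ₂ ∧ χ₁ ≠ χ₃ ∧ χ₂ ≠ χ₃ ∧ β ≠ 0 ∧ lam ≠ 0 ∧ c ≠ 0 ∧
          2 * c * lam ^ 2 * β * (2 - β) = 1 ∧
          f = (fun x => 1 / (lam * lam₂ * (2 - β)) * (χ₁ x - χ₃ x)) ∧
          g₁ = (fun x => (χ₁ x + χ₃ x) / 2) ∧
          h = (fun x => c * β * χ₁ x + c * (2 - β) * χ₂ x - 2 * c * χ₃ x) ∧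
          g₂ = (fun x => (-β * χ₁ x + (2 - β) * χ₂ x + 2 * χ₃ x) / (2 * (2 - β)))) ∨
      -- (8)
       (∃ (χ₁ χ₂ χ₃ : S →ₙ* ℂ) (β lam c : ℂ),
          χ₁ ≠ χ₂ ∧ χ₁ ≠ χ₃ ∧ χ₂ ≠ χ₃ ∧ β ≠ 0 ∧ lam ≠ 0 ∧ c ≠ 0 ∧
          2 * c * lam ^ 2 * β * (2 - β) = 1 ∧
          f = (fun x => -(1 / (lam * lam₂ * β)) * (χ₂ x - χ₃ x)) ∧
          g₁ = (fun x => (χ₂ x + χ₃ x) / 2) ∧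
          h = (fun x => c * β * χ₁ x + c * (2 - β) * χ₂ x - 2 * c * χ₃ x) ∧
          g₂ = (fun x => (β * χ₁ x - (2 - β) * χ₂ x + 2 * χ₃ x) / (2 * β)))) := by
  constructor
  · rintro ⟨hsol, hli⟩
    obtain ⟨a, b, hg, hg₂⟩ := exists_linear_relation hsol hlam₂ hli
    obtain ⟨hf, hh⟩ := hsol
    have indep : ∀ s t : ℂ, (∀ x, s * f x + t * h x = 0) → s = 0 ∧ t = 0 :=
      fun s t => forall_of_linearIndependent_pair hli
    obtain ⟨k, hk⟩ : ∃ k : ℂ, k ^ 2 = 2 * a + b ^ 2 := IsAlgClosed.exists_pow_nat_eq _ two_pos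
    have hχ : ∀ j : ℂ, j ^ 2 = 2 * a + b ^ 2 → ∀ x y,
        g₁ (x * y) + j * (lam₂ * f (x * y)) =
          (g₁ x + j * (lam₂ * f x)) * (g₁ y + j * (lam₂ * f y)) := by
      intro j hj x y
      have e := hf x y
      rw [hg x, hg y] at e
      rw [hg (x * y), hg x, hg y, hg₂, hh, e]
      linear_combination (-(lam₂ ^ 2 * f x * f y)) * hj
    by_cases ha : a = 0
    · have hg₂' : ∀ x y, g₂ (x * y) = g₂ x * g₂ y := fun x y => by rw [hg₂, ha]; ring
      let m : S →ₙ* ℂ := ⟨g₂, hg₂'⟩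
      have hm : ∀ x, m x = g₂ x := fun _ => rfl
      by_cases hb : b = 0
      · have hg₁ : ∀ x, g₁ x = m x := fun x => by rw [hg, ha, hb, hm]; ring
        have hf0 : f ≠ 0 := by
          rintro rfl
          simpa using (indep 1 0 (by simp)).1
        obtain ⟨hm0, A, hA, hA0, hfA⟩ := exists_additive_ne_zero_eq_psi hS (m := m) (P := f)
          (fun x y => by rw [hf, hg₁, hg₁]) hf0
        -- The term Ψ_m(A²) absorbs the inhomogeneity l² f(x) f(y), leaving a sine addition law.
        obtain ⟨B, hB, hPB⟩ := exists_additive_eq_psi hS (m := m)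
          (P := fun x => 2 * h x - lam₂ ^ 2 * Psi m (fun t => A t ^ 2) x) (fun x y => by
            rw [hh, psi_sq_mul hA, ← hfA, hm, hm]; ring)
        refine Or.inl ⟨m, A, B, hm0, hA, hB, hA0, hfA, funext hg₁, funext fun x => ?_, rfl⟩
        rw [psi_add_const_mul B (fun t => A t ^ 2) (lam₂ ^ 2), ← hPB]
        ring
      · have hμ : ∀ x y, g₂ (x * y) + 2 * b * (lam₂ * f (x * y)) =
            (g₂ x + 2 * b * (lam₂ * f x)) * (g₂ y + 2 * b * (lam₂ * f y)) := fun x y => by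
          have e := hχ b (by rw [ha]; ring) x y
          simp only [hg, ha] at e
          linear_combination e
        let μ : S →ₙ* ℂ := ⟨fun x => g₂ x + 2 * b * (lam₂ * f x), hμ⟩
        have hμ' : ∀ x, μ x = g₂ x + 2 * b * (lam₂ * f x) := fun _ => rfl
        have hg₁ : ∀ x, g₁ x = g₂ x + b * (lam₂ * f x) := fun x => by rw [hg, ha]; ring
        -- In this combination the products f(x) f(y) coming from f and from h cancel.
        obtain ⟨hm0, A, hA, hA0, hPA⟩ := exists_additive_ne_zero_eq_psi hS (m := m)
          (P := fun x => lam₂ * f x - 2 * b * h x)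
          (fun x y => by rw [hf, hh, hg₁, hg₁, hm, hm]; ring)
          (fun H => by
            have := (indep lam₂ (-(2 * b)) fun x => by
              have := congrFun H x
              simp only [Pi.zero_apply] at this
              linear_combination this).1
            exact hlam₂ this)
        refine Or.inr <| Or.inl ⟨m, μ, A, 1 / (2 * b * lam₂), hm0, ?_, hA, hA0,
          by simp [hb, hlam₂], funext fun x => ?_, funext fun x => ?_, funext fun x => ?_, rfl⟩
        · intro H
          have := (indep (2 * b * lam₂) 0 fun x => by
            have := DFunLike.congr_fun H x
            rw [hm, hμ'] at this
            linear_combination -this).1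
          simp [hb, hlam₂] at this
        · rw [hm, hμ']; field_simp; ring
        · rw [hm, hμ', hg₁]; ring
        · rw [hm, hμ', ← hPA]; field_simp; ring
    · have hX : ∀ x y, g₂ (x * y) - a * h (x * y) =
          (g₂ x - a * h x) * (g₂ y - a * h y) := fun x y => by rw [hg₂, hh]; ring
      let χ₃ : S →ₙ* ℂ := ⟨fun x => g₂ x - a * h x, hX⟩
      have hχ₃ : ∀ x, χ₃ x = g₂ x - a * h x := fun _ => rfl
      let χ₁ : S →ₙ* ℂ := ⟨fun x => g₁ x + k * (lam₂ * f x), hχ k hk⟩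
      have hχ₁ : ∀ x, χ₁ x = g₁ x + k * (lam₂ * f x) := fun _ => rfl
      have h13 : χ₁ ≠ χ₃ := by
        intro H
        have := (indep ((b + k) * lam₂) (2 * a) fun x => by
          have := DFunLike.congr_fun H x
          rw [hχ₁, hχ₃, hg] at this
          linear_combination this).2
        simp [ha] at this
      by_cases hk0 : k = 0
      · have hg₁ : ∀ x, g₁ x = χ₁ x := fun x => by rw [hχ₁, hk0]; ring
        have hb2 : b ^ 2 = -(2 * a) := by rw [hk0] at hk; linear_combination -hk
        have hb : b ≠ 0 := by
          rintro rfl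
          exact ha (by linear_combination hb2 / 2)
        obtain ⟨hm0, A, hA, hA0, hfA⟩ := exists_additive_ne_zero_eq_psi hS (m := χ₁)
          (P := fun x => lam₂ * f x)
          (fun x y => by rw [hf, hg₁, hg₁]; ring)
          (fun H => by
            have := (indep lam₂ 0 fun x => by
              have := congrFun H x
              simp only [Pi.zero_apply] at this
              linear_combination this).1
            exact hlam₂ this)
        -- With 2a = -b², one has χ₃ - χ₁ = b² h - b Ψ(A); solving for h gives c = -1/b.
        refine Or.inr <| Or.inr <| Or.inl ⟨χ₁, χ₃, A, -1 / b, hm0, h13, hA, hA0,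
          div_ne_zero (by norm_num) hb, funext fun x => ?_, funext hg₁, funext fun x => ?_,
          funext fun x => ?_⟩
        · rw [← hfA]; field_simp
        · rw [← hfA, hχ₃, ← hg₁, hg]; field_simp; linear_combination h x * hb2
        · rw [← hfA, hχ₃, ← hg₁, hg]; field_simp; ring
      · let χ₂ : S →ₙ* ℂ := ⟨fun x => g₁ x + -k * (lam₂ * f x), hχ (-k) (by rw [neg_sq, hk])⟩
        have hχ₂ : ∀ x, χ₂ x = g₁ x + -k * (lam₂ * f x) := fun _ => rfl
        have h12 : χ₁ ≠ χ₂ := by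
          intro H
          have := (indep (2 * k * lam₂) 0 fun x => by
            have := DFunLike.congr_fun H x
            rw [hχ₁, hχ₂] at this
            linear_combination this).1
          simp [hk0, hlam₂] at this
        have h23 : χ₂ ≠ χ₃ := by
          intro H
          have := (indep ((b - k) * lam₂) (2 * a) fun x => by
            have := DFunLike.congr_fun H x
            rw [hχ₂, hχ₃, hg] at this
            linear_combination this).2
          simp [ha] at this
        have hrel : 2 * (1 / (4 * a)) * k ^ 2 * (1 - b / k) * (2 - (1 - b / k)) = 1 := by
          field_simp
          linear_combination 2 * hk
        -- Solving for h: 4a h = (1 - b/k) χ₁ + (1 + b/k) χ₂ - 2 χ₃, which dictates β and c.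
        refine Or.inr <| Or.inr <| Or.inr <| Or.inr <| Or.inr <| Or.inl
          ⟨χ₁, χ₂, χ₃, 1 - b / k, k, 1 / (4 * a), h12, h13, h23, ?_, hk0, by simp [ha], hrel,
            funext fun x => ?_, funext fun x => ?_, funext fun x => ?_, funext fun x => ?_⟩
        · intro H
          simp [H] at hrel
        · rw [hχ₁, hχ₂]; field_simp; ring
        · rw [hχ₁, hχ₂]; ring
        · rw [hχ₁, hχ₂, hχ₃, hg]; field_simp; ring
        · rw [hχ₁, hχ₂, hχ₃, hg]; field_simp; ring
  · rintro (⟨m, A, A₁, -, hA, hA₁, hA0, rfl, rfl, rfl, rfl⟩ |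
      ⟨m, μ, A, α, -, hmμ, hA, hA0, hα, rfl, rfl, rfl, rfl⟩ |
      ⟨m, μ, A, c, -, hmμ, hA, hA0, hc, rfl, rfl, rfl, rfl⟩ |
      ⟨m, μ, A, c, d, -, hmμ, hA, hA0, hc, hd, hcd, rfl, rfl, rfl, rfl⟩ |
      ⟨m, μ, A, c, d, -, hmμ, hA, hA0, hc, hd, hcd, rfl, rfl, rfl, rfl⟩ |
      ⟨χ₁, χ₂, χ₃, β, k, c, h12, h13, h23, hβ, hk, hc, hrel, rfl, rfl, rfl, rfl⟩ |
      ⟨χ₁, χ₂, χ₃, β, k, c, h12, h13, h23, hβ, hk, hc, hrel, rfl, rfl, rfl, rfl⟩ |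
      ⟨χ₁, χ₂, χ₃, β, k, c, h12, h13, h23, hβ, hk, hc, hrel, rfl, rfl, rfl, rfl⟩)
    · exact isSolution_psi_sq hlam₂ hA hA₁ hA0
    · exact isSolution_sub_psi hlam₂ hmμ hA hA0 hα
    · exact isSolution_psi_sub hlam₂ hmμ hA hA0 hc
    · have hc' : c = 1 / d ^ 2 := by field_simp; linear_combination -hcd
      -- Since c = 1/d², form 4 is form 2 with this α; likewise form 5 is form 3 with -1/d in place
      -- of c.
      convert isSolution_sub_psi hlam₂ hmμ hA hA0 (α := -(1 / (d * lam₂)))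
        (by simp [hd, hlam₂]) using 5 <;>
        (subst hc'; field_simp; try ring)
    · have hc' : c = 1 / d ^ 2 := by field_simp; linear_combination -hcd
      convert isSolution_psi_sub hlam₂ hmμ hA hA0 (c := -(1 / d)) (by simp [hd]) using 5 <;>
        (subst hc'; field_simp; try ring)
    all_goals
      have hβ2 : 2 - β ≠ 0 := fun H => by simp [H] at hrel
    · exact isSolution_of_three_mulHom (k := 1 / (2 * k * lam₂)) h12 h13 h23 (by simp [hk, hlam₂])
        (r := -(2 * c)) (by simp [hc]) (p := c * β) (q := c * (2 - β)) (by ring)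
        (by field_simp; linear_combination hrel)
        (funext fun x => by field_simp) rfl (funext fun x => by ring)
        (funext fun x => by field_simp; ring)
    · exact isSolution_of_three_mulHom (k := 1 / (k * lam₂ * (2 - β))) h13 h12 h23.symm
        (by simp [hk, hlam₂, hβ2]) (r := c * (2 - β)) (mul_ne_zero hc hβ2) (p := c * β)
        (q := -(2 * c)) (by ring) (by field_simp; linear_combination -hrel)
        rfl rfl (funext fun x => by ring) (funext fun x => by field_simp; ring)
    · exact isSolution_of_three_mulHom (k := -(1 / (k * lam₂ * β))) h23 h12.symm h13.symm
        (by simp [hk, hlam₂, hβ]) (r := c * β) (mul_ne_zero hc hβ) (p := c * (2 - β))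
        (q := -(2 * c)) (by ring) (by field_simp; linear_combination -hrel)
        rfl rfl (funext fun x => by ring) (funext fun x => by field_simp; ring)
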